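/- **Theorem (privacy budget of DP-FedPGN).** *Algorithm.* Let $K,S,R,d$ be non-negative integers with $K,S\ge 1$, let $\eta>0$, $\gamma,\beta,\rho\in\mathbb R$, $C>0$, $\sigma>0$, $q\in[0,1]$, and let $(\tilde x^0,\tilde g^0)\in\mathbb R^d\times\mathbb R^d$ be public. A dataset is a finite family of $N\ge 0$ clients; client $i$ has a sample law $\mathcal D_i$ and a loss $F_i(x;\xi)$ whose stochastic gradient $\nabla_xF_i(x;\xi)$ is jointly measurable in $(x,\xi)$. In round $r=0,\dots,R-1$ a random set $\mathcal W^r$ of clients is drawn, each client belonging to it independently with probability $q$. Each $i\in\mathcal W^r$ starts from $x_i^{r,0}=\tilde x^r$ and makes $K$ local steps $$x_i^{r,k+1}=x_i^{r,k}-\eta\Big(\beta\nabla F_i\big(x_i^{r,k}+\rho\tfrac{\tilde g^r}{\|\tilde g^r\|};\xi_i^{r,k}\big)+(1-\beta)\tilde g^r\Big),\qquad \xi_i^{r,k}\sim\mathcal D_i,$$ (with no perturbation if $\tilde g^r=0$). Put $\bar\Delta_i^r=x_i^{r,K}-\tilde x^r+(1-\beta)K\eta\,\tilde g^r$ and $\hat\Delta_i^r=\bar\Delta_i^r\min(1,C/\|\bar\Delta_i^r\|_2)$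 (and $\hat\Delta_i^r=0$ if $\bar\Delta_i^r=0$). With $Z^r\sim\mathcal N(0,I_d)$, $$\tilde g^{r+1}=-\frac1{\eta SK}\Big(\sum_{i\in\mathcal W^r}\hat\Delta_i^r+\sigma C Z^r-S(1-\beta)K\eta\,\tilde g^r\Big),\qquad \tilde x^{r+1}=\tilde x^r-\gamma\tilde g^{r+1}.$$ All the samplings, samples $\xi_i^{r,k}$ and Gaussian vectors are independent. The mechanism $\mathcal M$ releases $(\tilde x^r,\tilde g^r)_{1\le r\le R}$. Two datasets are adjacent if one arises from the other by adding or removing one client. *Claim.* Let $\alpha>1$ and $\delta>0$ be real, let $\mu_0$ and $\mu_1$ be the densities of $\mathcal N(0,\sigma^2)$ and $\mathcal N(1,\sigma^2)$ on $\mathbb R$, and put $$\bar\epsilon=\frac{R}{\alpha-1}\ln\mathbb E_{z\sim\mu_0}\Big[\Big(1-q+\frac{q\,\mu_1(z)}{\mu_0(z)}\Big)^{\alpha}\Big],\qquad \epsilon=\bar\epsilon+\frac{(\alpha-1)\log(1-\frac1\alpha)-\log\alpha-\log\delta}{\alpha-1}.$$ Then the expectation is finite; $\mathcal M$ is $(\alpha,\bar\epsilon)$-Rényi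 differentially private, i.e. for all adjacent $D,D'$, $\mathcal M(D)\ll\mathcal M(D')$ and $\frac1{\alpha-1}\log\mathbb E_{\mathcal M(D')}\big[\big(\frac{d\mathcal M(D)}{d\mathcal M(D')}\big)^\alpha\big]\le\bar\epsilon$; and $\mathcal M$ is $(\epsilon,\delta)$-differentially private, i.e. for all adjacent $D,D'$ and every measurable set $O$ of outputs, $\Pr[\mathcal M(D)\in O]\le e^{\epsilon}\Pr[\mathcal M(D')\in O]+\delta$. -/

import Mathlib

open MeasureTheory ProbabilityTheory
open scoped ENNReal NNReal

noncomputable section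

namespace DPFedPGN

/-- The parameter space `ℝ^d` with the Euclidean norm. -/
abbrev Model (d : ℕ) : Type := EuclideanSpace ℝ (Fin d)

/-- The record of one client: the law of its stochastic sample (mini-batch) `ξ` and its loss
`F (x; ξ)`.  The only regularity asked for is that the stochastic gradient `∇ₓ F (x; ξ)` is jointly
measurable. -/
structure Client (d : ℕ) (Ξ : Type*) [MeasurableSpace Ξ] where
  sampleLaw : ProbabilityMeasure Ξ
  loss : Model d → Ξ → ℝ
  measurable_grad : Measurable fun p : Model d × Ξ => gradient (fun y => loss y p.2) p.1

/-- A federated dataset: finitely many clients, each with its record. -/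
abbrev Dataset (d : ℕ) (Ξ : Type*) [MeasurableSpace Ξ] : Type _ :=
  Σ N : ℕ, (Fin N → Client d Ξ)

/-- `D'` arises from `D` by removing (all the records of) one client. -/
def RemovesClient {d : ℕ} {Ξ : Type*} [MeasurableSpace Ξ] (D D' : Dataset d Ξ) : Prop :=
  ∃ (N : ℕ) (c : Fin (N + 1) → Client d Ξ) (j : Fin (N + 1)),
    D = ⟨N + 1, c⟩ ∧ D' = ⟨N, fun i => c (j.succAbove i)⟩

/-- Client-level adjacency: one dataset arises from the other by adding or removing one client. -/
def Adjacent {d : ℕ} {Ξ : Type*} [MeasurableSpace Ξ] (D D' : Dataset d Ξ) : Prop :=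
  RemovesClient D D' ∨ RemovesClient D' D

/-! ### Differential privacy -/

/-- `(ε, δ)`-differential privacy of a randomized mechanism, given by its output laws. -/
def IsDP {𝒟 Y : Type*} [MeasurableSpace Y] (adj : 𝒟 → 𝒟 → Prop) (M : 𝒟 → Measure Y)
    (ε δ : ℝ) : Prop :=
  ∀ D D' : 𝒟, adj D D' → ∀ O : Set Y, MeasurableSet O →
    M D O ≤ ENNReal.ofReal (Real.exp ε) * M D' O + ENNReal.ofReal δ

open Classical in
/-- The Rényi divergence of order `α`, `(α - 1)⁻¹ log 𝔼_Q [(dP/dQ)^α]`, and `∞` if `P` is not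
absolutely continuous with respect to `Q`. -/
def renyiDiv {Y : Type*} [MeasurableSpace Y] (α : ℝ) (P Q : Measure Y) : EReal :=
  if P ≪ Q then
    (((α - 1)⁻¹ : ℝ) : EReal) * ENNReal.log (∫⁻ y, (P.rnDeriv Q y) ^ α ∂Q)
  else ⊤

/-- `(α, ε)`-Rényi differential privacy. -/
def IsRDP {𝒟 Y : Type*} [MeasurableSpace Y] (adj : 𝒟 → 𝒟 → Prop) (M : 𝒟 → Measure Y)
    (α ε : ℝ) : Prop :=
  ∀ D D' : 𝒟, adj D D' → renyiDiv α (M D) (M D') ≤ (ε : EReal)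

/-! ### The algorithm -/

/-- The public hyper-parameters: number `K` of local steps, nominal number `S` of participating
clients, local and global learning rates `η`, `γ`, momentum `β`, perturbation radius `ρ`, clipping
threshold `C`, noise standard deviation (noise multiplier) `σ`, client sampling rate `q`. -/
structure Params where
  K : ℕ
  S : ℕ
  η : ℝ
  γ : ℝ
  β : ℝ
  ρ : ℝ
  C : ℝ≥0
  σ : ℝ≥0
  q : unitInterval

variable {d : ℕ} {Ξ : Type*} [MeasurableSpace Ξ]

/-- One local step:
`x ↦ x - η (β ∇F (x + ρ g / ‖g‖; ξ) + (1 - β) g)` (no perturbation if `g = 0`). -/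
def localStep (p : Params) (c : Client d Ξ) (g : Model d) (ξ : Ξ) (x : Model d) : Model d :=
  x - p.η • (p.β • gradient (fun y => c.loss y ξ) (x + (p.ρ / ‖g‖) • g) + (1 - p.β) • g)

/-- The local model after the local steps with the samples `ξ 0, ξ 1, …`, in this order. -/
def localRun (p : Params) (c : Client d Ξ) (g : Model d) :
    (k : ℕ) → (Fin k → Ξ) → Model d → Model d
  | 0, _, x => x
  | k + 1, ξ, x => localRun p c g k (Fin.tail ξ) (localStep p c g (ξ 0) x)

/-- The local update with the momentum term taken out, `x^K - x + (1 - β) K η g`. -/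
def localUpdate (p : Params) (c : Client d Ξ) (ξ : Fin p.K → Ξ) (x g : Model d) : Model d :=
  localRun p c g p.K ξ x - x + ((1 - p.β) * p.K * p.η) • g

/-- Clipping to norm at most `C`. -/
def clip (C : ℝ≥0) (v : Model d) : Model d :=
  min 1 ((C : ℝ) / ‖v‖) • v

/-- The randomness of one round with `N` clients: who is sampled, the samples `ξ i k` of each
client, and a standard Gaussian vector. -/
abbrev RoundNoise (d : ℕ) (Ξ : Type*) (N K : ℕ) : Type _ :=
  (Fin N → Bool) × (Fin N → Fin K → Ξ) × Model d

/-- Each client takes part independently with probability `q`; the samples of client `i` are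
i.i.d. with its own law; the Gaussian vector is standard; all these are independent. -/
def roundNoiseLaw (p : Params) {N : ℕ} (c : Fin N → Client d Ξ) :
    Measure (RoundNoise d Ξ N p.K) :=
  (Measure.pi fun _ : Fin N => bernoulliMeasure true false p.q).prod
    ((Measure.pi fun i : Fin N => Measure.pi fun _ : Fin p.K =>
      ((c i).sampleLaw : Measure Ξ)).prod (stdGaussian (Model d)))

/-- The sum of the clipped updates of the sampled clients plus Gaussian noise
`N(0, σ² C² I_d)`. -/
def noisySum (p : Params) {N : ℕ} (c : Fin N → Client d Ξ) (ω : RoundNoise d Ξ N p.K)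
    (x g : Model d) : Model d :=
  (∑ i, if ω.1 i then clip p.C (localUpdate p (c i) (ω.2.1 i) x g) else 0)
    + ((p.σ : ℝ) * p.C) • ω.2.2

/-- One communication round on the state `(x, g)`: the momentum term is reinstated for `S` clients,
`g⁺ = -(noisySum - S (1 - β) K η g) / (η S K)` and `x⁺ = x - γ g⁺`. -/
def round (p : Params) {N : ℕ} (c : Fin N → Client d Ξ) (ω : RoundNoise d Ξ N p.K)
    (s : Model d × Model d) : Model d × Model d :=
  let g' : Model d := (1 / (p.η * p.S * p.K)) •
    -(noisySum p c ω s.1 s.2 - (p.S * ((1 - p.β) * p.K * p.η)) • s.2)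
  (s.1 - p.γ • g', g')

/-- The states `(x^1, g^1), …, (x^R, g^R)` after the successive rounds, from the state `s`. -/
def run (p : Params) {N : ℕ} (c : Fin N → Client d Ξ) :
    (R : ℕ) → (Fin R → RoundNoise d Ξ N p.K) → Model d × Model d → (Fin R → Model d × Model d)
  | 0, _, _ => Fin.elim0
  | R + 1, ω, s =>
      Fin.cons (round p c (ω 0) s) (run p c R (Fin.tail ω) (round p c (ω 0) s))

/-- The mechanism: `R` rounds with independent randomness, from the public initial state
`(x^0, g^0)`; all the global models and global gradient estimates are released. -/
def mechanism (p : Params) (R : ℕ) (x₀ g₀ : Model d) (D : Dataset d Ξ) :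
    Measure (Fin R → Model d × Model d) :=
  (Measure.pi fun _ : Fin R => roundNoiseLaw p D.2).map fun ω => run p D.2 R ω (x₀, g₀)

/-! ### Sanity: the mechanism outputs a probability distribution -/

theorem measurable_localRun (p : Params) (c : Client d Ξ) (k : ℕ) :
    Measurable fun a : (Fin k → Ξ) × Model d × Model d => localRun p c a.2.2 k a.1 a.2.1 := by
  induction k with
  | zero => exact measurable_snd.fst
  | succ k ih =>
    have h0 : Measurable fun a : (Fin (k + 1) → Ξ) × Model d × Model d => a.1 0 :=
      (measurable_pi_apply 0).comp measurable_fst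
    have ht : Measurable fun a : (Fin (k + 1) → Ξ) × Model d × Model d => Fin.tail a.1 :=
      measurable_pi_lambda _ fun i => (measurable_pi_apply i.succ).comp measurable_fst
    have hx : Measurable fun a : (Fin (k + 1) → Ξ) × Model d × Model d => a.2.1 := by fun_prop
    have hg : Measurable fun a : (Fin (k + 1) → Ξ) × Model d × Model d => a.2.2 := by fun_prop
    have hG := c.measurable_grad.comp
      ((hx.add ((hg.norm.const_div p.ρ).smul hg)).prodMk h0)
    have hs : Measurable fun a : (Fin (k + 1) → Ξ) × Model d × Model d =>
        localStep p c a.2.2 (a.1 0) a.2.1 :=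
      hx.sub (((hG.const_smul p.β).add (hg.const_smul (1 - p.β))).const_smul p.η)
    exact ih.comp (ht.prodMk (hs.prodMk hg))

theorem measurable_round (p : Params) {N : ℕ} (c : Fin N → Client d Ξ) :
    Measurable fun a : RoundNoise d Ξ N p.K × (Model d × Model d) => round p c a.1 a.2 := by
  have hu (i : Fin N) : Measurable fun a : RoundNoise d Ξ N p.K × (Model d × Model d) =>
      localUpdate p (c i) (a.1.2.1 i) a.2.1 a.2.2 := by
    have h := (measurable_localRun p (c i) p.K).comp
      (f := fun a : RoundNoise d Ξ N p.K × (Model d × Model d) => (a.1.2.1 i, a.2.1, a.2.2))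
      (by fun_prop)
    unfold localUpdate
    exact (h.sub (by fun_prop)).add (by fun_prop)
  have hn : Measurable fun a : RoundNoise d Ξ N p.K × (Model d × Model d) =>
      noisySum p c a.1 a.2.1 a.2.2 := by
    unfold noisySum clip
    refine (Finset.measurable_sum _ fun i _ => Measurable.ite ?_ ?_ measurable_const).add
      (by fun_prop)
    · exact measurableSet_eq_fun (by fun_prop) measurable_const
    · exact (measurable_const.min ((hu i).norm.const_div _)).smul (hu i)
  have hg : Measurable fun a : RoundNoise d Ξ N p.K × (Model d × Model d) =>
      (round p c a.1 a.2).2 :=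
    ((hn.sub (by fun_prop)).neg).const_smul (1 / (p.η * p.S * p.K))
  exact ((by fun_prop : Measurable fun a : RoundNoise d Ξ N p.K × (Model d × Model d) =>
    a.2.1).sub (hg.const_smul p.γ)).prodMk hg

theorem measurable_run (p : Params) {N : ℕ} (c : Fin N → Client d Ξ) (R : ℕ) :
    Measurable fun a : (Fin R → RoundNoise d Ξ N p.K) × (Model d × Model d) =>
      run p c R a.1 a.2 := by
  induction R with
  | zero => exact measurable_pi_lambda _ fun i => i.elim0
  | succ R ih =>
    have hr := (measurable_round p c).comp
      (f := fun a : (Fin (R + 1) → RoundNoise d Ξ N p.K) × (Model d × Model d) => (a.1 0, a.2))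
      (by fun_prop)
    have ht : Measurable fun a : (Fin (R + 1) → RoundNoise d Ξ N p.K) × (Model d × Model d) =>
        Fin.tail a.1 :=
      measurable_pi_lambda _ fun i => (measurable_pi_apply i.succ).comp measurable_fst
    have hc := ih.comp (ht.prodMk hr)
    refine measurable_pi_lambda _ fun i => ?_
    refine Fin.cases ?_ (fun j => ?_) i
    · simpa [run, Function.comp_def] using hr
    · simpa [run, Function.comp_def] using (measurable_pi_apply j).comp hc

instance (p : Params) {N : ℕ} (c : Fin N → Client d Ξ) :
    IsProbabilityMeasure (roundNoiseLaw p c) := by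
  unfold roundNoiseLaw
  infer_instance

instance (p : Params) (R : ℕ) (x₀ g₀ : Model d) (D : Dataset d Ξ) :
    IsProbabilityMeasure (mechanism p R x₀ g₀ D) :=
  Measure.isProbabilityMeasure_map
    ((measurable_run p D.2 R).comp (measurable_id.prodMk measurable_const)).aemeasurable

/-! ### The privacy budget -/

/-- The likelihood-ratio moment integrand `(1 - q + q μ₁(z) / μ₀(z))^α`, where `μ₀`, `μ₁` are the
densities of `N(0, σ²)` and `N(1, σ²)`. -/
def ratioPow (q : ℝ) (σ : ℝ≥0) (α z : ℝ) : ℝ :=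
  (1 - q + q * gaussianPDFReal 1 (σ ^ 2) z / gaussianPDFReal 0 (σ ^ 2) z) ^ α

/-- `ε̄ = R / (α - 1) · ln 𝔼_{z ∼ μ₀} [(1 - q + q μ₁(z) / μ₀(z))^α]`. -/
def rdpBudget (R : ℕ) (q : ℝ) (σ : ℝ≥0) (α : ℝ) : ℝ :=
  R / (α - 1) * Real.log (∫ z, ratioPow q σ α z ∂(gaussianReal 0 (σ ^ 2)))

/-- `ε = ε̄ + ((α - 1) log (1 - 1/α) - log α - log δ) / (α - 1)`. -/
def dpBudget (R : ℕ) (q : ℝ) (σ : ℝ≥0) (α δ : ℝ) : ℝ :=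
  rdpBudget R q σ α
    + ((α - 1) * Real.log (1 - 1 / α) - Real.log α - Real.log δ) / (α - 1)

end DPFedPGN

end

/-! The bound 𝔼_Q[(dP/dQ)^α] ≤ M is used throughout in its dual form `HolderBound`: ∫ f dP ≤ M^{1/α}
(∫ f^β dQ)^{1/β} for all measurable f ≥ 0, with 1/α + 1/β = 1. No density appears in it. It passes
to images, because f may be replaced by f ∘ g; to averages over a common parameter, by Jensen; and
to adaptive compositions, where the constants multiply. Densities are needed only for real Gaussian
laws, and return at the end in `HolderBound.lintegral_rnDeriv_le`.

Fix the state before a round, and fix all the randomness except the noise and the selection of the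
extra client j. The noisy sums are then Gaussian about some x without j, and a (1 - q, q) mixture of
Gaussians about x and x + u with j, where ‖u‖ ≤ C by clipping. Since ‖u‖ ≤ C, the noise σ C Z can be
split as w u + T z with w ∼ N(0, σ²) and z independent, and the shift by u only changes the mean of
w to 1 (`exists_map_gaussianReal_prod_stdGaussian`). What remains is N(0, σ²) against its mixture
with N(1, σ²).

With r the density of the mixture, removing a client costs 𝔼_{μ₀}[r^α], which is the moment in the
budget. Adding one costs 𝔼_{μ₀}[r^{1-α}], which is no larger: symmetrizing under z ↦ 1 - z, which
exchanges the two Gaussians, leaves the pointwise inequality `two_point_rpow_le`. Composing R rounds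
gives the R-th power of the moment (`holderBound_run`). Testing with an indicator and applying
weighted AM-GM gives (ε, δ)-privacy. -/

namespace DPFedPGN

/-! ### Dual form of Rényi bounds -/

section HolderBound

variable {Y : Type*} [MeasurableSpace Y] {α β : ℝ}

/-- The dual form of the bound `∫ (dP/dQ)^α dQ ≤ M`, for the exponent `β` conjugate to `α`. -/
def HolderBound (α β : ℝ) (M : ℝ≥0∞) (P Q : Measure Y) : Prop :=
  ∀ f : Y → ℝ≥0∞, Measurable f →
    ∫⁻ y, f y ∂P ≤ M ^ (1 / α) * (∫⁻ y, f y ^ β ∂Q) ^ (1 / β)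

theorem lintegral_le_rpow_lintegral_rpow (h : α.HolderConjugate β) (μ : Measure Y)
    [IsProbabilityMeasure μ] {f : Y → ℝ≥0∞} (hf : AEMeasurable f μ) :
    ∫⁻ y, f y ∂μ ≤ (∫⁻ y, f y ^ β ∂μ) ^ (1 / β) := by
  simpa using ENNReal.lintegral_mul_le_Lp_mul_Lq μ h (f := fun _ => 1) aemeasurable_const hf

theorem rpow_lintegral_le_lintegral_rpow (h : α.HolderConjugate β) (μ : Measure Y)
    [IsProbabilityMeasure μ] {f : Y → ℝ≥0∞} (hf : AEMeasurable f μ) :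
    (∫⁻ y, f y ∂μ) ^ β ≤ ∫⁻ y, f y ^ β ∂μ := by
  have h1 := ENNReal.rpow_le_rpow (lintegral_le_rpow_lintegral_rpow h μ hf) h.symm.nonneg
  rwa [one_div, ENNReal.rpow_inv_rpow h.symm.ne_zero] at h1

/-- A bound on the averages follows from a bound for each parameter. -/
theorem lintegral_le_of_forall_le {T : Type*} [MeasurableSpace T] (h : α.HolderConjugate β)
    (ν : Measure T) [IsProbabilityMeasure ν] {c : ℝ≥0∞} {F G : T → ℝ≥0∞} (hG : Measurable G)
    (hFG : ∀ t, F t ≤ c * G t ^ (1 / β)) :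
    ∫⁻ t, F t ∂ν ≤ c * (∫⁻ t, G t ∂ν) ^ (1 / β) := by
  calc ∫⁻ t, F t ∂ν ≤ ∫⁻ t, c * G t ^ (1 / β) ∂ν := lintegral_mono hFG
    _ = c * ∫⁻ t, G t ^ (1 / β) ∂ν := lintegral_const_mul _ (hG.pow_const _)
    _ ≤ c * (∫⁻ t, (G t ^ (1 / β)) ^ β ∂ν) ^ (1 / β) := by
      gcongr
      exact lintegral_le_rpow_lintegral_rpow h ν (hG.pow_const _).aemeasurable
    _ = c * (∫⁻ t, G t ∂ν) ^ (1 / β) := by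
      simp_rw [one_div, ENNReal.rpow_inv_rpow h.symm.ne_zero]

theorem holderBound_of_withDensity (h : α.HolderConjugate β) {P Q : Measure Y} {M : ℝ≥0∞}
    {g : Y → ℝ≥0∞} (hg : Measurable g) (hP : P = Q.withDensity g)
    (hM : ∫⁻ y, g y ^ α ∂Q ≤ M) : HolderBound α β M P Q := by
  intro f hf
  rw [hP, lintegral_withDensity_eq_lintegral_mul _ hg hf]
  refine (ENNReal.lintegral_mul_le_Lp_mul_Lq Q h hg.aemeasurable hf.aemeasurable).trans ?_
  exact mul_le_mul_left (ENNReal.rpow_le_rpow hM (one_div_nonneg.2 h.nonneg)) _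

namespace HolderBound

variable {P Q : Measure Y} {M : ℝ≥0∞}

theorem measure_le (h : α.HolderConjugate β) (H : HolderBound α β M P Q) {s : Set Y}
    (hs : MeasurableSet s) : P s ≤ M ^ (1 / α) * Q s ^ (1 / β) := by
  have h1 := H (s.indicator 1) (measurable_one.indicator hs)
  have h2 : ∀ y, s.indicator (1 : Y → ℝ≥0∞) y ^ β = s.indicator 1 y := fun y => by
    by_cases hy : y ∈ s <;> simp [hy, h.symm.pos]
  simpa [h2, lintegral_indicator_one hs] using h1

theorem absolutelyContinuous (h : α.HolderConjugate β) (H : HolderBound α β M P Q) :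
    P ≪ Q := by
  refine Measure.AbsolutelyContinuous.mk fun s hs h0 => ?_
  have h1 := H.measure_le h hs
  rw [h0, ENNReal.zero_rpow_of_pos (one_div_pos.2 h.symm.pos), mul_zero] at h1
  exact le_antisymm h1 zero_le

/-- Converse half of the duality: the extremal test function is r^{α-1} for r = dP/dQ, since (α - 1)
β = α. -/
theorem lintegral_rnDeriv_le [IsProbabilityMeasure P] [IsProbabilityMeasure Q]
    (h : α.HolderConjugate β) (H : HolderBound α β M P Q) :
    ∫⁻ y, P.rnDeriv Q y ^ α ∂Q ≤ M := by
  have hac := H.absolutelyContinuous h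
  set r := P.rnDeriv Q with hr
  have hrm : Measurable r := Measure.measurable_rnDeriv P Q
  have hsup : ∀ y, r y ^ α = ⨆ n : ℕ, (min (r y) n) ^ α := fun y => by
    have h1 : r y = ⨆ n : ℕ, min (r y) n := by
      rw [← inf_iSup_eq, ENNReal.iSup_natCast, inf_top_eq]
    conv_lhs => rw [h1]
    exact (ENNReal.monotone_rpow_of_nonneg h.nonneg).map_iSup_of_continuousAt
      ENNReal.continuous_rpow_const.continuousAt (by simp [h.pos])
  simp_rw [hsup]
  rw [lintegral_iSup (fun n => (hrm.min measurable_const).pow_const _)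
    fun m n hmn y => by dsimp only; gcongr; exact h.nonneg]
  refine iSup_le fun n => ?_
  -- Truncating r at n makes I finite, so that I^{1/β} can be cancelled from I ≤ M^{1/α} I^{1/β};
  -- monotone convergence has already reduced the claim to these truncations.
  set I := ∫⁻ y, min (r y) n ^ α ∂Q with hI
  have hIfin : I ≠ ∞ := by
    refine ((lintegral_mono (g := fun _ => (n : ℝ≥0∞) ^ α) fun y => ?_).trans_lt ?_).ne
    · exact ENNReal.rpow_le_rpow (min_le_right _ _) h.nonneg
    · simp [ENNReal.rpow_lt_top_of_nonneg h.nonneg]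
  have h1 := H (fun y => min (r y) n ^ (α - 1)) ((hrm.min measurable_const).pow_const _)
  have h2 : I ≤ ∫⁻ y, min (r y) n ^ (α - 1) ∂P := by
    rw [← lintegral_rnDeriv_mul hac ((hrm.min measurable_const).pow_const _).aemeasurable]
    refine lintegral_mono fun y => ?_
    calc min (r y) n ^ α = min (r y) n * min (r y) n ^ (α - 1) := by
          conv_rhs => enter [1]; rw [← ENNReal.rpow_one (min (r y) (n : ℝ≥0∞))]
          rw [← ENNReal.rpow_add_of_nonneg _ _ zero_le_one h.sub_one_pos.le]
          congr 1; ring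
      _ ≤ r y * min (r y) n ^ (α - 1) := by gcongr; exact min_le_left _ _
  have h3 : ∀ y, (min (r y) (n : ℝ≥0∞) ^ (α - 1)) ^ β = min (r y) n ^ α := fun y => by
    rw [← ENNReal.rpow_mul, h.sub_one_mul_conj]
  simp_rw [h3] at h1
  have h4 : I ≤ M ^ (1 / α) * I ^ (1 / β) := h2.trans h1
  rcases eq_or_ne I 0 with h0 | h0
  · rw [h0]; exact zero_le
  have h5 : I ^ (1 / α) * I ^ (1 / β) ≤ M ^ (1 / α) * I ^ (1 / β) := by
    rw [← ENNReal.rpow_add _ _ h0 hIfin, one_div, one_div, h.inv_add_inv_eq_one, ENNReal.rpow_one]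
    simpa [one_div] using h4
  have h6 : I ^ (1 / α) ≤ M ^ (1 / α) :=
    (ENNReal.mul_le_mul_iff_left (by simp [h0, hIfin]) (by simp [h0, hIfin])).1 h5
  exact (ENNReal.rpow_le_rpow_iff (one_div_pos.2 h.pos)).1 h6

theorem renyiDiv_le [IsProbabilityMeasure P] [IsProbabilityMeasure Q]
    (h : α.HolderConjugate β) {m : ℝ} (hm : 0 < m)
    (H : HolderBound α β (ENNReal.ofReal m) P Q) :
    renyiDiv α P Q ≤ (((α - 1)⁻¹ * Real.log m : ℝ) : EReal) := by
  rw [renyiDiv, if_pos (H.absolutelyContinuous h), EReal.coe_mul,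
    ← ENNReal.log_ofReal_of_pos hm]
  exact mul_le_mul_of_nonneg_left
    (ENNReal.log_le_log (H.lintegral_rnDeriv_le h))
    (EReal.coe_nonneg.2 (inv_nonneg.2 h.sub_one_pos.le))

/-- Conversion of a Rényi bound to approximate differential privacy. -/
theorem measure_le_exp_mul_add [IsProbabilityMeasure P] [IsProbabilityMeasure Q]
    (h : α.HolderConjugate β) {m δ : ℝ} (hm : 0 < m) (hδ : 0 < δ)
    (H : HolderBound α β (ENNReal.ofReal m) P Q) {s : Set Y} (hs : MeasurableSet s) :
    P s ≤ ENNReal.ofReal (Real.exp ((α - 1)⁻¹ * Real.log m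
      + ((α - 1) * Real.log (1 - 1 / α) - Real.log α - Real.log δ) / (α - 1))) * Q s
      + ENNReal.ofReal δ := by
  have h1 := H.measure_le h hs
  have hα := h.pos
  have hα1 := h.sub_one_pos
  have hc : 0 < 1 - 1 / α := by rw [sub_pos, div_lt_one hα]; linarith
  have hβ : 1 / β = 1 - 1 / α := by have := h.inv_add_inv_eq_one; simp only [one_div]; linarith
  set E := Real.exp ((α - 1)⁻¹ * Real.log m
      + ((α - 1) * Real.log (1 - 1 / α) - Real.log α - Real.log δ) / (α - 1)) with hE
  set x := (Q s).toReal with hx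
  have hx0 : 0 ≤ x := ENNReal.toReal_nonneg
  have hQ : Q s = ENNReal.ofReal x := (ENNReal.ofReal_toReal (measure_ne_top _ _)).symm
  have key : m ^ (1 / α) * x ^ (1 - 1 / α) ≤ E * x + δ := by
    have hE0 : 0 < E := Real.exp_pos _
    -- AM-GM with weights 1/α and 1 - 1/α. The first point is chosen to contribute exactly δ and the
    -- second exactly E x; the value of E is the one for which the geometric mean equals m^{1/α}
    -- x^{1-1/α}.
    have := Real.geom_mean_le_arith_mean2_weighted (w₁ := 1 / α) (w₂ := 1 - 1 / α)
      (p₁ := α * δ) (p₂ := E * x / (1 - 1 / α)) (by positivity) hc.le (by positivity)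
      (by positivity) (by ring)
    have e1 : 1 / α * (α * δ) + (1 - 1 / α) * (E * x / (1 - 1 / α)) = E * x + δ := by
      field_simp; ring
    rw [e1] at this
    refine le_of_eq_of_le ?_ this
    rw [mul_div_right_comm, Real.mul_rpow (by positivity) hx0, ← mul_assoc]
    congr 1
    apply Real.log_injOn_pos (Set.mem_Ioi.2 (by positivity)) (Set.mem_Ioi.2 (by positivity))
    rw [Real.log_rpow hm, Real.log_mul (by positivity) (by positivity),
      Real.log_rpow (by positivity), Real.log_rpow (by positivity), Real.log_mul hα.ne' hδ.ne',
      Real.log_div hE0.ne' hc.ne', hE, Real.log_exp]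
    field_simp
    ring
  calc P s ≤ _ := h1
    _ = ENNReal.ofReal (m ^ (1 / α) * x ^ (1 - 1 / α)) := by
      rw [hQ, hβ, ENNReal.ofReal_rpow_of_pos hm, ENNReal.ofReal_rpow_of_nonneg hx0 hc.le,
        ← ENNReal.ofReal_mul (by positivity)]
    _ ≤ ENNReal.ofReal (E * x + δ) := ENNReal.ofReal_le_ofReal key
    _ = _ := by
      rw [ENNReal.ofReal_add (by positivity) hδ.le, ENNReal.ofReal_mul (by positivity), hQ]

end HolderBound

end HolderBound

/-! ### The two-point inequality -/

/-- The second derivative is α (α - 1) (x^{α-2} - x^{-α-1}), nonnegative for x ≥ 1 because α - 2 ≥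
-α - 1. -/
theorem convexOn_rpow_sub_rpow {α : ℝ} (hα : 1 < α) :
    ConvexOn ℝ (Set.Ici 1) fun x : ℝ => x ^ α - x ^ (1 - α) := by
  refine convexOn_of_hasDerivWithinAt2_nonneg (convex_Ici 1)
    (f' := fun x => α * x ^ (α - 1) - (1 - α) * x ^ (1 - α - 1))
    (f'' := fun x => α * ((α - 1) * x ^ (α - 1 - 1))
      - (1 - α) * ((1 - α - 1) * x ^ (1 - α - 1 - 1))) ?_ ?_ ?_ ?_
  · intro x hx
    have hx0 : x ≠ 0 := (zero_lt_one.trans_le hx).ne'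
    exact ((Real.continuousAt_rpow_const x _ (Or.inl hx0)).sub
      (Real.continuousAt_rpow_const x _ (Or.inl hx0))).continuousWithinAt
  · intro x hx
    rw [interior_Ici] at hx
    have hx0 : x ≠ 0 := (zero_lt_one.trans hx).ne'
    exact ((Real.hasDerivAt_rpow_const (Or.inl hx0)).sub
      (Real.hasDerivAt_rpow_const (Or.inl hx0))).hasDerivWithinAt
  · intro x hx
    rw [interior_Ici] at hx
    have hx0 : x ≠ 0 := (zero_lt_one.trans hx).ne'
    exact (((Real.hasDerivAt_rpow_const (Or.inl hx0)).const_mul _).sub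
      ((Real.hasDerivAt_rpow_const (Or.inl hx0)).const_mul _)).hasDerivWithinAt
  · intro x hx
    rw [interior_Ici] at hx
    have h1 : x ^ (1 - α - 1 - 1) ≤ x ^ (α - 1 - 1) :=
      Real.rpow_le_rpow_of_exponent_le (le_of_lt hx) (by linarith)
    have h2 : 0 ≤ α * (α - 1) * (x ^ (α - 1 - 1) - x ^ (1 - α - 1 - 1)) :=
      mul_nonneg (mul_nonneg (by linarith) (by linarith)) (sub_nonneg.2 h1)
    nlinarith

/-- Put φ(x) = x^α - x^{1-α}, a = 1 - q + q L, b = 1 - q + q/L and c = 1/b. As φ(b) = -b φ(c), the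
claim is L b φ(c) ≤ φ(a). Since a - 1 = L b (c - 1), this compares the slopes of the chords of φ
from 1 to c and from 1 to a; φ is convex on [1, ∞) with φ(1) = 0, and c ≤ a because a b ≥ 1. -/
theorem two_point_rpow_le_of_one_le {α q L : ℝ} (hα : 1 < α) (hq0 : 0 ≤ q) (hq1 : q ≤ 1)
    (hL : 1 ≤ L) :
    (1 - q + q * L) ^ (1 - α) + L * (1 - q + q * L⁻¹) ^ (1 - α)
      ≤ (1 - q + q * L) ^ α + L * (1 - q + q * L⁻¹) ^ α := by
  have hL0 : 0 < L := by linarith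
  have hLi : L⁻¹ ≤ 1 := inv_le_one_of_one_le₀ hL
  have hLi0 : 0 < L⁻¹ := inv_pos.2 hL0
  have hLL : L * L⁻¹ = 1 := mul_inv_cancel₀ hL0.ne'
  set a := 1 - q + q * L with ha
  set b := 1 - q + q * L⁻¹ with hb
  have ha1 : 1 ≤ a := by nlinarith
  have hb1 : b ≤ 1 := by nlinarith
  have hb0 : 0 < b := by
    rcases hq0.eq_or_lt with h | h
    · rw [hb, ← h]; norm_num
    · have := mul_pos h hLi0; linarith
  set c := b⁻¹ with hc
  have hc1 : 1 ≤ c := (one_le_inv₀ hb0).2 hb1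
  have hbc : b * c = 1 := mul_inv_cancel₀ hb0.ne'
  have hab : 1 ≤ a * b := by
    have h1 : a * b - 1 = q * (1 - q) * ((L - 1) * (1 - L⁻¹)) := by
      rw [ha, hb]; linear_combination (q * q + q * (1 - q)) * hLL
    have h2 : 0 ≤ q * (1 - q) * ((L - 1) * (1 - L⁻¹)) :=
      mul_nonneg (mul_nonneg hq0 (by linarith)) (mul_nonneg (by linarith) (by linarith))
    linarith
  have hca : c ≤ a := by
    rw [hc]; exact (inv_le_iff_one_le_mul₀ hb0).2 (by linarith)
  set φ : ℝ → ℝ := fun x => x ^ α - x ^ (1 - α) with hφ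
  have hφ1 : φ 1 = 0 := by simp [hφ]
  have hφb : φ b = -(b * φ c) := by
    have h1 : b * c ^ α = b ^ (1 - α) := by
      rw [hc, Real.inv_rpow hb0.le, Real.rpow_sub hb0, Real.rpow_one]; rfl
    have h2 : b * c ^ (1 - α) = b ^ α := by
      rw [hc, Real.inv_rpow hb0.le, ← Real.rpow_neg hb0.le]
      nth_rw 1 [← Real.rpow_one b]
      rw [← Real.rpow_add hb0]; congr 1; ring
    simp only [hφ]; rw [mul_sub, h1, h2]; ring
  suffices L * b * φ c ≤ φ a by
    have h1 : 0 ≤ φ a + L * φ b := by rw [hφb]; linarith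
    simp only [hφ] at h1
    linarith
  -- For c = 1 the chord from 1 to c degenerates, but then φ(c) = 0 and only φ(a) ≥ 0 is needed.
  rcases hc1.eq_or_lt with h | h
  · rw [← h, hφ1, mul_zero]
    exact sub_nonneg.2 (Real.rpow_le_rpow_of_exponent_le ha1 (by linarith))
  · have h1 := (convexOn_rpow_sub_rpow hα).secant_mono (a := 1) (x := c) (y := a)
      Set.self_mem_Ici hc1 ha1 h.ne' (h.trans_le hca).ne' hca
    change (φ c - φ 1) / _ ≤ (φ a - φ 1) / _ at h1
    rw [hφ1, sub_zero, sub_zero, div_le_div_iff₀ (by linarith) (by linarith)] at h1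
    have h2 : a - 1 = L * b * (c - 1) := by
      rw [ha]
      have : L * b * (c - 1) = L * (b * c) - L * b := by ring
      rw [this, hbc, hb]; linear_combination q * hLL
    rw [h2] at h1
    exact le_of_mul_le_mul_right (by linarith) (sub_pos.2 h)

/-- The Rényi divergences between the two-point laws `P` proportional to `(1, L)` and
`(1 - q) P + q P'`, where `P'` is proportional to `(L, 1)`, compared in both orders. -/
theorem two_point_rpow_le {α q L : ℝ} (hα : 1 < α) (hq0 : 0 ≤ q) (hq1 : q ≤ 1) (hL : 0 < L) :
    (1 - q + q * L) ^ (1 - α) + L * (1 - q + q * L⁻¹) ^ (1 - α)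
      ≤ (1 - q + q * L) ^ α + L * (1 - q + q * L⁻¹) ^ α := by
  rcases le_total 1 L with h | h
  · exact two_point_rpow_le_of_one_le hα hq0 hq1 h
  -- Replacing L by 1/L and multiplying by L exchanges the two summands on each side.
  · have h1 := mul_le_mul_of_nonneg_left
      (two_point_rpow_le_of_one_le hα hq0 hq1 ((one_le_inv₀ hL).2 h)) hL.le
    rw [inv_inv, mul_add, mul_add, mul_inv_cancel_left₀ hL.ne', mul_inv_cancel_left₀ hL.ne'] at h1
    linarith

/-! ### Real Gaussian mixtures -/

/-- The likelihood ratio of `N(1, v)` and `N(0, v)`. -/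
noncomputable def gaussianRatio (v : ℝ≥0) (z : ℝ) : ℝ :=
  gaussianPDFReal 1 v z / gaussianPDFReal 0 v z

/-- The likelihood ratio of `(1 - q) N(0, v) + q N(1, v)` and `N(0, v)`. -/
noncomputable def mixtureRatio (q : ℝ) (v : ℝ≥0) (z : ℝ) : ℝ :=
  1 - q + q * gaussianRatio v z

/-- The mixture `(1 - q) N(0, v) + q N(1, v)`. -/
noncomputable def gaussianMixture (q : ℝ) (v : ℝ≥0) : Measure ℝ :=
  (gaussianReal 0 v).withDensity fun z => ENNReal.ofReal (mixtureRatio q v z)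

section

variable {v : ℝ≥0}

theorem gaussianRatio_pos (hv : v ≠ 0) (z : ℝ) : 0 < gaussianRatio v z :=
  div_pos (gaussianPDFReal_pos _ _ _ hv) (gaussianPDFReal_pos _ _ _ hv)

theorem gaussianRatio_eq_exp (hv : v ≠ 0) (z : ℝ) :
    gaussianRatio v z = Real.exp (v⁻¹ * z - (2 * v)⁻¹) := by
  have hv' : (v : ℝ) ≠ 0 := by simpa
  have hv0 : (0 : ℝ) < v := by positivity
  have hs : √(2 * Real.pi * v) ≠ 0 := by positivity
  rw [gaussianRatio, gaussianPDFReal, gaussianPDFReal, mul_div_mul_left _ _ (inv_ne_zero hs),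
    ← Real.exp_sub]
  congr 1
  push_cast
  field_simp
  ring

theorem measurable_gaussianRatio : Measurable (gaussianRatio v) :=
  (measurable_gaussianPDFReal _ _).div (measurable_gaussianPDFReal _ _)

theorem measurable_mixtureRatio (q : ℝ) : Measurable (mixtureRatio q v) :=
  (measurable_gaussianRatio.const_mul q).const_add (1 - q)

theorem mixtureRatio_pos {q : ℝ} (hq0 : 0 ≤ q) (hq1 : q ≤ 1) (hv : v ≠ 0) (z : ℝ) :
    0 < mixtureRatio q v z := by
  have h := gaussianRatio_pos hv z
  unfold mixtureRatio
  rcases hq0.eq_or_lt with h0 | h0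
  · rw [← h0]; norm_num
  · have := mul_pos h0 h; linarith

theorem ratioPow_eq (q : ℝ) (σ : ℝ≥0) (α z : ℝ) :
    ratioPow q σ α z = mixtureRatio q (σ ^ 2) z ^ α := by
  rw [ratioPow, mixtureRatio, gaussianRatio, mul_div_assoc]

theorem gaussianRatio_one_sub (z : ℝ) : gaussianRatio v (1 - z) = (gaussianRatio v z)⁻¹ := by
  rw [gaussianRatio, gaussianRatio, inv_div]
  simp only [gaussianPDFReal]
  congr 4 <;> ring

theorem gaussianReal_one_eq_withDensity (hv : v ≠ 0) :
    gaussianReal 1 v =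
      (gaussianReal 0 v).withDensity fun z => ENNReal.ofReal (gaussianRatio v z) := by
  rw [gaussianReal_of_var_ne_zero _ hv, gaussianReal_of_var_ne_zero _ hv,
    ← withDensity_mul _ (measurable_gaussianPDF _ _) measurable_gaussianRatio.ennreal_ofReal]
  congr 1
  ext z
  rw [Pi.mul_apply, gaussianPDF, gaussianPDF, ← ENNReal.ofReal_mul (gaussianPDFReal_nonneg _ _ _),
    gaussianRatio, mul_div_cancel₀ _ (gaussianPDFReal_pos 0 v z hv).ne']

theorem lintegral_gaussianMixture {q : ℝ} (hq0 : 0 ≤ q) (hq1 : q ≤ 1) (hv : v ≠ 0)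
    {f : ℝ → ℝ≥0∞} (hf : Measurable f) :
    ∫⁻ z, f z ∂gaussianMixture q v =
      ENNReal.ofReal (1 - q) * ∫⁻ z, f z ∂gaussianReal 0 v
        + ENNReal.ofReal q * ∫⁻ z, f z ∂gaussianReal 1 v := by
  rw [gaussianMixture,
    lintegral_withDensity_eq_lintegral_mul _ (measurable_mixtureRatio q).ennreal_ofReal hf,
    gaussianReal_one_eq_withDensity hv,
    lintegral_withDensity_eq_lintegral_mul _ measurable_gaussianRatio.ennreal_ofReal hf,
    ← lintegral_const_mul _ hf,
    ← lintegral_const_mul _ (measurable_gaussianRatio.ennreal_ofReal.mul hf),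
    ← lintegral_add_left (hf.const_mul _)]
  refine lintegral_congr fun z => ?_
  have hL := gaussianRatio_pos hv z
  simp only [Pi.mul_apply, mixtureRatio]
  rw [ENNReal.ofReal_add (by linarith) (by positivity), ENNReal.ofReal_mul hq0, add_mul, mul_assoc]

/-- The reflection z ↦ 1 - z carries N(1, v) to N(0, v), and N(1, v) has density `gaussianRatio v`
with respect to N(0, v). -/
theorem lintegral_gaussianReal_eq_reflect (hv : v ≠ 0) {f : ℝ → ℝ≥0∞} (hf : Measurable f) :
    ∫⁻ z, f z ∂gaussianReal 0 v =
      ∫⁻ z, ENNReal.ofReal (gaussianRatio v z) * f (1 - z) ∂gaussianReal 0 v := by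
  have hm : Measurable fun z : ℝ => 1 - z := measurable_const.sub measurable_id
  have h1 : gaussianReal 0 v = (gaussianReal 1 v).map fun z => 1 - z := by
    rw [gaussianReal_map_const_sub, sub_self]
  conv_lhs => rw [h1]
  rw [lintegral_map hf hm, gaussianReal_one_eq_withDensity hv,
    lintegral_withDensity_eq_lintegral_mul _ measurable_gaussianRatio.ennreal_ofReal
      (g := fun z => f (1 - z)) (hf.comp hm)]
  rfl

/-- Averaging each integral with its reflected form turns the likelihood ratio L into the pair L,
1/L with weights 1, L, and the integrands are then compared pointwise by `two_point_rpow_le`. -/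
theorem lintegral_mixtureRatio_rpow_le {α q : ℝ} (hα : 1 < α) (hq0 : 0 ≤ q) (hq1 : q ≤ 1)
    (hv : v ≠ 0) :
    ∫⁻ z, ENNReal.ofReal (mixtureRatio q v z ^ (1 - α)) ∂gaussianReal 0 v
      ≤ ∫⁻ z, ENNReal.ofReal (mixtureRatio q v z ^ α) ∂gaussianReal 0 v := by
  have hm (s : ℝ) : Measurable fun z => ENNReal.ofReal (mixtureRatio q v z ^ s) :=
    ((measurable_mixtureRatio q).pow_const s).ennreal_ofReal
  have htwo (s : ℝ) : 2 * ∫⁻ z, ENNReal.ofReal (mixtureRatio q v z ^ s) ∂gaussianReal 0 v =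
      ∫⁻ z, ENNReal.ofReal ((1 - q + q * gaussianRatio v z) ^ s
        + gaussianRatio v z * (1 - q + q * (gaussianRatio v z)⁻¹) ^ s) ∂gaussianReal 0 v := by
    rw [two_mul]
    nth_rw 2 [lintegral_gaussianReal_eq_reflect hv (hm s)]
    rw [← lintegral_add_left (hm s)]
    refine lintegral_congr fun z => ?_
    have h1 := mixtureRatio_pos hq0 hq1 hv z
    have h2 := mixtureRatio_pos hq0 hq1 hv (1 - z)
    have h3 := gaussianRatio_pos hv z
    rw [← ENNReal.ofReal_mul h3.le, ← ENNReal.ofReal_add (by positivity) (by positivity),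
      mixtureRatio, mixtureRatio, gaussianRatio_one_sub]
  have h : 2 * ∫⁻ z, ENNReal.ofReal (mixtureRatio q v z ^ (1 - α)) ∂gaussianReal 0 v
      ≤ 2 * ∫⁻ z, ENNReal.ofReal (mixtureRatio q v z ^ α) ∂gaussianReal 0 v := by
    rw [htwo, htwo]
    exact lintegral_mono fun z => ENNReal.ofReal_le_ofReal
      (two_point_rpow_le hα hq0 hq1 (gaussianRatio_pos hv z))
  exact (ENNReal.mul_le_mul_iff_right (by simp) (by simp)).1 h

/-- The ratio is at most 2 max(1, L), and L^α is the exponential of an affine function of z, hence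
Gaussian-integrable. -/
theorem integrable_mixtureRatio_rpow {α q : ℝ} (hα : 0 ≤ α) (hq0 : 0 ≤ q) (hq1 : q ≤ 1)
    (hv : v ≠ 0) : Integrable (fun z => mixtureRatio q v z ^ α) (gaussianReal 0 v) := by
  have hexp : Integrable (fun z => 2 ^ α * (1 + Real.exp (-(α * (2 * v)⁻¹)) *
      Real.exp (α * v⁻¹ * z))) (gaussianReal 0 v) :=
    ((integrable_const 1).add ((integrable_exp_mul_gaussianReal _).const_mul _)).const_mul _
  refine hexp.mono' ((measurable_mixtureRatio q).pow_const α).aestronglyMeasurable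
    (Filter.Eventually.of_forall fun z => ?_)
  have hr := mixtureRatio_pos hq0 hq1 hv z
  have hL := gaussianRatio_pos hv z
  rw [Real.norm_of_nonneg (by positivity)]
  have hLα : gaussianRatio v z ^ α =
      Real.exp (-(α * (2 * v)⁻¹)) * Real.exp (α * v⁻¹ * z) := by
    rw [gaussianRatio_eq_exp hv, ← Real.exp_mul, ← Real.exp_add]
    congr 1; ring
  rw [← hLα]
  have h1 : mixtureRatio q v z ≤ 2 * max 1 (gaussianRatio v z) := by
    unfold mixtureRatio
    have := le_max_left 1 (gaussianRatio v z)
    have := le_max_right 1 (gaussianRatio v z)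
    nlinarith
  calc mixtureRatio q v z ^ α ≤ (2 * max 1 (gaussianRatio v z)) ^ α :=
        Real.rpow_le_rpow hr.le h1 hα
    _ = 2 ^ α * max 1 (gaussianRatio v z) ^ α := Real.mul_rpow (by norm_num) (by positivity)
    _ ≤ _ := by
      gcongr
      rcases max_cases 1 (gaussianRatio v z) with h | h <;> rw [h.1]
      · rw [Real.one_rpow]; linarith [Real.rpow_nonneg hL.le α]
      · linarith

theorem integrable_ratioPow {q α : ℝ} {σ : ℝ≥0} (hα : 0 ≤ α) (hq0 : 0 ≤ q) (hq1 : q ≤ 1)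
    (hσ : σ ≠ 0) : Integrable (ratioPow q σ α) (gaussianReal 0 (σ ^ 2)) := by
  rw [funext (ratioPow_eq q σ α)]
  exact integrable_mixtureRatio_rpow hα hq0 hq1 (pow_ne_zero 2 hσ)

/-- The moment `𝔼_{z ∼ N(0, v)} [(1 - q + q μ₁(z) / μ₀(z))^α]`. -/
noncomputable def mixtureMoment (α q : ℝ) (v : ℝ≥0) : ℝ :=
  ∫ z, mixtureRatio q v z ^ α ∂gaussianReal 0 v

theorem lintegral_mixtureRatio_rpow {α q : ℝ} (hα : 0 ≤ α) (hq0 : 0 ≤ q) (hq1 : q ≤ 1)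
    (hv : v ≠ 0) :
    ∫⁻ z, ENNReal.ofReal (mixtureRatio q v z ^ α) ∂gaussianReal 0 v
      = ENNReal.ofReal (mixtureMoment α q v) :=
  (ofReal_integral_eq_lintegral_ofReal (integrable_mixtureRatio_rpow hα hq0 hq1 hv)
    (Filter.Eventually.of_forall fun z =>
      Real.rpow_nonneg (mixtureRatio_pos hq0 hq1 hv z).le _)).symm

theorem holderBound_gaussianMixture {α β q : ℝ} (h : α.HolderConjugate β) (hq0 : 0 ≤ q)
    (hq1 : q ≤ 1) (hv : v ≠ 0) :
    HolderBound α β (ENNReal.ofReal (mixtureMoment α q v)) (gaussianMixture q v)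
      (gaussianReal 0 v) := by
  refine holderBound_of_withDensity h (measurable_mixtureRatio q).ennreal_ofReal rfl ?_
  rw [← lintegral_mixtureRatio_rpow h.nonneg hq0 hq1 hv]
  exact (lintegral_congr fun z =>
    ENNReal.ofReal_rpow_of_pos (mixtureRatio_pos hq0 hq1 hv z)).le

/-- Here the density is 1/r relative to the mixture r μ₀, so its α-th moment is 𝔼_{μ₀}[r^{1-α}],
which `lintegral_mixtureRatio_rpow_le` bounds. -/
theorem holderBound_gaussianMixture_symm {α β q : ℝ} (h : α.HolderConjugate β) (hq0 : 0 ≤ q)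
    (hq1 : q ≤ 1) (hv : v ≠ 0) :
    HolderBound α β (ENNReal.ofReal (mixtureMoment α q v)) (gaussianReal 0 v)
      (gaussianMixture q v) := by
  have hr := mixtureRatio_pos hq0 hq1 hv
  have hm := (measurable_mixtureRatio (v := v) q).ennreal_ofReal
  have hmi := (measurable_mixtureRatio (v := v) q).inv.ennreal_ofReal
  refine holderBound_of_withDensity h hmi ?_ ?_
  · rw [gaussianMixture, ← withDensity_mul _ hm hmi]
    conv_lhs => rw [← withDensity_one (μ := gaussianReal 0 v)]
    congr 1
    ext z
    simp only [Pi.one_apply, Pi.mul_apply, Pi.inv_apply]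
    rw [← ENNReal.ofReal_mul (hr z).le, mul_inv_cancel₀ (hr z).ne', ENNReal.ofReal_one]
  · rw [← lintegral_mixtureRatio_rpow h.nonneg hq0 hq1 hv]
    refine le_of_eq_of_le ?_ (lintegral_mixtureRatio_rpow_le h.lt hq0 hq1 hv)
    rw [gaussianMixture, lintegral_withDensity_eq_lintegral_mul _ hm (hmi.pow_const _)]
    refine lintegral_congr fun z => ?_
    simp only [Pi.mul_apply, Pi.inv_apply]
    rw [ENNReal.ofReal_rpow_of_pos (inv_pos.2 (hr z)), ← ENNReal.ofReal_mul (hr z).le,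
      Real.inv_rpow (hr z).le, Real.rpow_sub (hr z), Real.rpow_one, div_eq_mul_inv]

end

/-! ### Reduction of a Gaussian shift to one dimension -/

section GaussianShift

variable {E : Type*} [NormedAddCommGroup E] [InnerProductSpace ℝ E]

/-- The symmetric rank-one perturbation `z ↦ z - κ ⟪u, z⟫ u` of the identity. -/
noncomputable def rankOneShrink (κ : ℝ) (u z : E) : E := z - (κ * inner ℝ u z) • u

theorem inner_rankOneShrink (κ : ℝ) (u z t : E) :
    inner ℝ (rankOneShrink κ u z) t = inner ℝ z (rankOneShrink κ u t) := by
  simp only [rankOneShrink, inner_sub_left, inner_sub_right, real_inner_smul_left,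
    real_inner_smul_right, real_inner_comm u z]
  ring

theorem norm_rankOneShrink_sq (κ : ℝ) (u t : E) :
    ‖rankOneShrink κ u t‖ ^ 2 = ‖t‖ ^ 2 - (2 * κ - κ ^ 2 * ‖u‖ ^ 2) * inner ℝ u t ^ 2 := by
  rw [rankOneShrink, norm_sub_sq_real, real_inner_smul_right, norm_smul, mul_pow,
    real_inner_comm u t, Real.norm_eq_abs, sq_abs]
  ring

/-- With r = ‖u‖, this equation says that u uᵀ + C² (1 - κ u uᵀ)² = C² · 1. It has a real root
exactly when r ≤ C. -/
theorem exists_shrink_coeff {C r : ℝ} (hC : 0 < C) (hr0 : 0 ≤ r) (hr : r ≤ C) :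
    ∃ κ : ℝ, C ^ 2 * (2 * κ - κ ^ 2 * r ^ 2) = 1 := by
  have h0 : 0 ≤ 1 - r ^ 2 / C ^ 2 := by
    rw [sub_nonneg, div_le_one (by positivity)]
    gcongr
  set s := √(1 - r ^ 2 / C ^ 2) with hs
  have hs0 : 0 ≤ s := Real.sqrt_nonneg _
  have hs2 : s ^ 2 = 1 - r ^ 2 / C ^ 2 := Real.sq_sqrt h0
  have hr2 : r ^ 2 = C ^ 2 * (1 - s ^ 2) := by rw [hs2]; field_simp; ring
  -- The smaller root (1 - s)/r² of the quadratic, rationalized so that it also makes sense for r =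
  -- 0.
  refine ⟨1 / (C ^ 2 * (1 + s)), ?_⟩
  rw [hr2]
  field_simp
  ring

variable [FiniteDimensional ℝ E] [MeasurableSpace E] [BorelSpace E]

theorem measurable_rankOneShrink (κ : ℝ) (u : E) : Measurable (rankOneShrink κ u) := by
  unfold rankOneShrink
  fun_prop

/-- A Gaussian vector shifted by `b u` is the image of a real Gaussian variable of mean `b`,
under a random affine map that does not depend on `b`. -/
theorem exists_map_gaussianReal_prod_stdGaussian {C : ℝ} (hC : 0 < C) (σ : ℝ≥0) {u : E}
    (hu : ‖u‖ ≤ C) : ∃ T : E → E, Measurable T ∧ ∀ b : ℝ,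
      ((gaussianReal b (σ ^ 2)).prod (stdGaussian E)).map (fun p => p.1 • u + T p.2) =
        (stdGaussian E).map fun z => b • u + ((σ : ℝ) * C) • z := by
  obtain ⟨κ, hκ⟩ := exists_shrink_coeff hC (norm_nonneg u) hu
  have hT : Measurable fun z => ((σ : ℝ) * C) • rankOneShrink κ u z :=
    (measurable_rankOneShrink κ u).const_smul _
  refine ⟨_, hT, fun b => ?_⟩
  have hm1 : Measurable fun p : ℝ × E => p.1 • u + ((σ : ℝ) * C) • rankOneShrink κ u p.2 :=
    (measurable_fst.smul_const u).add (hT.comp measurable_snd)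
  have hm2 : Measurable fun z : E => b • u + ((σ : ℝ) * C) • z := by fun_prop
  have := Measure.isProbabilityMeasure_map (μ := (gaussianReal b (σ ^ 2)).prod (stdGaussian E))
    hm1.aemeasurable
  have := Measure.isProbabilityMeasure_map (μ := stdGaussian E) hm2.aemeasurable
  -- On both sides the characteristic function is a phase b⟪u, t⟫ times a Gaussian factor, so only
  -- the variances in direction t need to agree; this is `hκ`.
  refine Measure.ext_of_charFun (funext fun t => ?_)
  have hl : charFun (((gaussianReal b (σ ^ 2)).prod (stdGaussian E)).map
      fun p => p.1 • u + ((σ : ℝ) * C) • rankOneShrink κ u p.2) t =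
      charFun (gaussianReal b (σ ^ 2)) (inner ℝ u t) *
        charFun (stdGaussian E) (((σ : ℝ) * C) • rankOneShrink κ u t) := by
    rw [charFun_apply, integral_map hm1.aemeasurable (by fun_prop), charFun_apply_real,
      charFun_apply, ← integral_prod_mul]
    refine integral_congr_ae (Filter.Eventually.of_forall fun p => ?_)
    simp only
    rw [← Complex.exp_add, inner_add_left, real_inner_smul_left, real_inner_smul_left,
      inner_rankOneShrink, real_inner_smul_right]
    congr 1
    push_cast
    ring
  have hr : charFun ((stdGaussian E).map fun z => b • u + ((σ : ℝ) * C) • z) t =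
      charFun (stdGaussian E) (((σ : ℝ) * C) • t) *
        Complex.exp (inner ℝ (b • u) t * Complex.I) := by
    rw [← charFun_map_smul, ← charFun_map_const_add, Measure.map_map (by fun_prop) (by fun_prop)]
    rfl
  rw [hl, hr, charFun_gaussianReal, charFun_stdGaussian, charFun_stdGaussian, ← Complex.exp_add,
    ← Complex.exp_add, real_inner_smul_left]
  congr 1
  have h1 : ‖((σ : ℝ) * C) • rankOneShrink κ u t‖ ^ 2 =
      ‖((σ : ℝ) * C) • t‖ ^ 2 - (σ : ℝ) ^ 2 * inner ℝ u t ^ 2 := by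
    rw [norm_smul, norm_smul, mul_pow, mul_pow, norm_rankOneShrink_sq, Real.norm_eq_abs, sq_abs]
    linear_combination (-(σ : ℝ) ^ 2 * inner ℝ u t ^ 2) * hκ
  have h2 := congrArg (fun x : ℝ => (x : ℂ)) h1
  push_cast at h2 ⊢
  rw [h2]
  ring

/-- The expectation of `f` at `x` perturbed by Gaussian noise of standard deviation `τ`. -/
noncomputable def gaussianAverage (τ : ℝ) (f : E → ℝ≥0∞) (x : E) : ℝ≥0∞ :=
  ∫⁻ z, f (x + τ • z) ∂stdGaussian E

theorem measurable_gaussianAverage (τ : ℝ) {f : E → ℝ≥0∞} (hf : Measurable f) :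
    Measurable (gaussianAverage τ f) :=
  Measurable.lintegral_prod_right' (f := fun p : E × E => f (p.1 + τ • p.2))
    (hf.comp (by fun_prop))

/-- The inner integral is a function of w alone and does not involve b, so averages at x and x + u
are integrals of one function of a real variable against N(0, σ²) and N(1, σ²). -/
theorem gaussianAverage_shift {C : ℝ} {σ : ℝ≥0} {u : E} {T : E → E} (hT : Measurable T)
    (h : ∀ b : ℝ, ((gaussianReal b (σ ^ 2)).prod (stdGaussian E)).map
      (fun p => p.1 • u + T p.2) = (stdGaussian E).map fun z => b • u + ((σ : ℝ) * C) • z)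
    {f : E → ℝ≥0∞} (hf : Measurable f) (x : E) (b : ℝ) :
    gaussianAverage (σ * C) f (x + b • u) =
      ∫⁻ w, ∫⁻ z, f (x + (w • u + T z)) ∂stdGaussian E ∂gaussianReal b (σ ^ 2) := by
  have hx : Measurable fun y => f (x + y) := hf.comp (by fun_prop)
  have hm : Measurable fun p : ℝ × E => p.1 • u + T p.2 :=
    (measurable_fst.smul_const u).add (hT.comp measurable_snd)
  have h1 := congrArg (fun μ => ∫⁻ y, f (x + y) ∂μ) (h b)
  rw [lintegral_map hx hm, lintegral_map hx (by fun_prop),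
    lintegral_prod (fun p : ℝ × E => f (x + (p.1 • u + T p.2))) (hx.comp hm).aemeasurable] at h1
  rw [gaussianAverage, h1]
  simp only [add_assoc]

variable {α β q C : ℝ} {σ : ℝ≥0} {u : E}

theorem subsampled_gaussianAverage_le (h : α.HolderConjugate β) (hq0 : 0 ≤ q) (hq1 : q ≤ 1)
    (hσ : σ ≠ 0) (hC : 0 < C) (hu : ‖u‖ ≤ C) {f : E → ℝ≥0∞} (hf : Measurable f) (x : E) :
    ENNReal.ofReal (1 - q) * gaussianAverage (σ * C) f x
        + ENNReal.ofReal q * gaussianAverage (σ * C) f (x + u)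
      ≤ ENNReal.ofReal (mixtureMoment α q (σ ^ 2)) ^ (1 / α)
        * gaussianAverage (σ * C) (fun y => f y ^ β) x ^ (1 / β) := by
  obtain ⟨T, hT, hb⟩ := exists_map_gaussianReal_prod_stdGaussian hC σ hu
  have hv : σ ^ 2 ≠ 0 := pow_ne_zero 2 hσ
  have hm : Measurable fun p : ℝ × E => x + (p.1 • u + T p.2) :=
    ((measurable_fst.smul_const u).add (hT.comp measurable_snd)).const_add x
  have hg : Measurable fun w => ∫⁻ z, f (x + (w • u + T z)) ∂stdGaussian E :=
    (hf.comp hm).lintegral_prod_right'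
  have h0 (g : E → ℝ≥0∞) (hg : Measurable g) := gaussianAverage_shift hT hb hg x 0
  have h1 := gaussianAverage_shift hT hb hf x 1
  simp only [zero_smul, add_zero] at h0
  rw [one_smul] at h1
  rw [h0 f hf, h0 _ (hf.pow_const β), h1, ← lintegral_gaussianMixture hq0 hq1 hv hg]
  -- The one-dimensional bound produces (∫ f dz)^β inside the integral over w; Jensen in z replaces
  -- it by ∫ f^β dz.
  refine (holderBound_gaussianMixture h hq0 hq1 hv _ hg).trans ?_
  gcongr with w
  · exact one_div_nonneg.2 h.symm.nonneg
  · exact rpow_lintegral_le_lintegral_rpow h _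
      (hf.comp (hm.comp measurable_prodMk_left)).aemeasurable

theorem gaussianAverage_le_subsampled (h : α.HolderConjugate β) (hq0 : 0 ≤ q) (hq1 : q ≤ 1)
    (hσ : σ ≠ 0) (hC : 0 < C) (hu : ‖u‖ ≤ C) {f : E → ℝ≥0∞} (hf : Measurable f) (x : E) :
    gaussianAverage (σ * C) f x
      ≤ ENNReal.ofReal (mixtureMoment α q (σ ^ 2)) ^ (1 / α)
        * (ENNReal.ofReal (1 - q) * gaussianAverage (σ * C) (fun y => f y ^ β) x
          + ENNReal.ofReal q * gaussianAverage (σ * C) (fun y => f y ^ β) (x + u)) ^ (1 / β) := by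
  obtain ⟨T, hT, hb⟩ := exists_map_gaussianReal_prod_stdGaussian hC σ hu
  have hv : σ ^ 2 ≠ 0 := pow_ne_zero 2 hσ
  have hm : Measurable fun p : ℝ × E => x + (p.1 • u + T p.2) :=
    ((measurable_fst.smul_const u).add (hT.comp measurable_snd)).const_add x
  have hg (g : E → ℝ≥0∞) (hg : Measurable g) :
      Measurable fun w => ∫⁻ z, g (x + (w • u + T z)) ∂stdGaussian E :=
    (hg.comp hm).lintegral_prod_right'
  have h0 (g : E → ℝ≥0∞) (hg : Measurable g) := gaussianAverage_shift hT hb hg x 0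
  have h1 := gaussianAverage_shift hT hb (hf.pow_const β) x 1
  simp only [zero_smul, add_zero] at h0
  rw [one_smul] at h1
  rw [h0 f hf, h0 _ (hf.pow_const β), h1,
    ← lintegral_gaussianMixture hq0 hq1 hv (hg _ (hf.pow_const β))]
  refine (holderBound_gaussianMixture_symm h hq0 hq1 hv _ (hg f hf)).trans ?_
  gcongr with w
  · exact one_div_nonneg.2 h.symm.nonneg
  · exact rpow_lintegral_le_lintegral_rpow h _
      (hf.comp (hm.comp measurable_prodMk_left)).aemeasurable

end GaussianShift

/-! ### Subsampling one extra client -/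

theorem lintegral_bernoulliMeasure_bool (q : unitInterval) (g : Bool → ℝ≥0∞) :
    ∫⁻ a, g a ∂bernoulliMeasure true false q =
      ENNReal.ofReal (1 - q) * g false + ENNReal.ofReal q * g true := by
  have h1 : ENNReal.ofReal (q : ℝ) = unitInterval.toNNReal q := by
    rw [ENNReal.ofReal]; congr 1; ext; simp [q.2.1]
  have h2 : ENNReal.ofReal (1 - q : ℝ) = unitInterval.toNNReal (unitInterval.symm q) := by
    rw [ENNReal.ofReal]; congr 1; ext; simp [q.2.2]
  rw [bernoulliMeasure_def, lintegral_add_measure, h1, h2, add_comm]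
  simp only [ENNReal.smul_def, lintegral_smul_measure, lintegral_dirac, smul_eq_mul]

/-- Meant for a = selection bit of client j, c = its samples, and (b, d) = the same data for the
other clients: the bit becomes the innermost variable. -/
theorem lintegral_prod_prod_comm {A B C D : Type*} [MeasurableSpace A] [MeasurableSpace B]
    [MeasurableSpace C] [MeasurableSpace D] (μ : Measure A) (ν : Measure B) (μ' : Measure C)
    (ν' : Measure D) [SFinite μ] [SFinite ν] [SFinite μ'] [SFinite ν']
    {h : (A × B) × (C × D) → ℝ≥0∞} (hh : Measurable h) :
    ∫⁻ x, h x ∂(μ.prod ν).prod (μ'.prod ν') =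
      ∫⁻ y, ∫⁻ c, ∫⁻ a, h ((a, y.1), (c, y.2)) ∂μ ∂μ' ∂ν.prod ν' := by
  have h3 : Measurable fun y : (B × D) × C => ∫⁻ a, h ((a, y.1.1), (y.2, y.1.2)) ∂μ :=
    Measurable.lintegral_prod_right'
      (f := fun z : ((B × D) × C) × A => h ((z.2, z.1.1.1), (z.1.2, z.1.1.2)))
      (hh.comp (by fun_prop))
  have h4 : Measurable fun y : B × D => ∫⁻ c, ∫⁻ a, h ((a, y.1), (c, y.2)) ∂μ ∂μ' :=
    h3.lintegral_prod_right'
  rw [lintegral_prod _ hh.aemeasurable, lintegral_prod_symm _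
    (Measurable.lintegral_prod_right' hh).aemeasurable, lintegral_prod _ h4.aemeasurable]
  refine lintegral_congr fun b => ?_
  rw [lintegral_lintegral_swap (f := fun a r => h ((a, b), r)) (hh.comp (by fun_prop)).aemeasurable,
    lintegral_prod_symm _ (Measurable.lintegral_prod_left'
      (f := fun z : A × (C × D) => h ((z.1, b), z.2)) (hh.comp (by fun_prop))).aemeasurable]

section Subsample

variable {Ω E : Type*} [MeasurableSpace Ω] [NormedAddCommGroup E] [InnerProductSpace ℝ E]
  [FiniteDimensional ℝ E] [MeasurableSpace E] [BorelSpace E] {N : ℕ}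

/-- The sum of the contributions `U i (ξ i)` of the selected indices. -/
def subsampleSum (U : Fin N → Ω → E) (b : Fin N → Bool) (ξ : Fin N → Ω) : E :=
  ∑ i, if b i then U i (ξ i) else 0

theorem measurable_subsampleSum {U : Fin N → Ω → E} (hU : ∀ i, Measurable (U i)) :
    Measurable fun x : (Fin N → Bool) × (Fin N → Ω) => subsampleSum U x.1 x.2 := by
  refine Finset.measurable_sum _ fun i _ => Measurable.ite ?_ ?_ measurable_const
  · exact measurableSet_eq_fun (by fun_prop) measurable_const
  · exact (hU i).comp (by fun_prop)

theorem lintegral_subsampleSum_add_noise (q : unitInterval) (ν : Fin N → Measure Ω)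
    [∀ i, IsProbabilityMeasure (ν i)] {U : Fin N → Ω → E} (hU : ∀ i, Measurable (U i)) (τ : ℝ)
    {f : E → ℝ≥0∞} (hf : Measurable f) :
    ∫⁻ ω, f (subsampleSum U ω.1 ω.2.1 + τ • ω.2.2)
        ∂(Measure.pi fun _ : Fin N => bernoulliMeasure true false q).prod
          ((Measure.pi ν).prod (stdGaussian E)) =
      ∫⁻ x, gaussianAverage τ f (subsampleSum U x.1 x.2)
        ∂(Measure.pi fun _ : Fin N => bernoulliMeasure true false q).prod (Measure.pi ν) := by
  have hS := measurable_subsampleSum hU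
  have hm : Measurable fun ω : (Fin N → Bool) × (Fin N → Ω) × E =>
      f (subsampleSum U ω.1 ω.2.1 + τ • ω.2.2) :=
    hf.comp ((hS.comp (f := fun ω : (Fin N → Bool) × (Fin N → Ω) × E => (ω.1, ω.2.1))
      (by fun_prop)).add (by fun_prop))
  rw [lintegral_prod _ hm.aemeasurable,
    lintegral_prod (fun x : (Fin N → Bool) × (Fin N → Ω) =>
      gaussianAverage τ f (subsampleSum U x.1 x.2))
      ((measurable_gaussianAverage τ hf).comp hS).aemeasurable]
  exact lintegral_congr fun b => lintegral_prod _ (hm.comp measurable_prodMk_left).aemeasurable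

/-- Conditioning on everything but the selection of the index `j`. -/
theorem lintegral_subsampleSum_succAbove (q : unitInterval) (ν : Fin (N + 1) → Measure Ω)
    [∀ i, IsProbabilityMeasure (ν i)] {U : Fin (N + 1) → Ω → E} (hU : ∀ i, Measurable (U i))
    (j : Fin (N + 1)) {g : E → ℝ≥0∞} (hg : Measurable g) :
    ∫⁻ x, g (subsampleSum U x.1 x.2)
        ∂(Measure.pi fun _ : Fin (N + 1) => bernoulliMeasure true false q).prod (Measure.pi ν) =
      ∫⁻ y, ∫⁻ η, (ENNReal.ofReal (1 - q) * g (subsampleSum (fun i => U (j.succAbove i)) y.1 y.2)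
          + ENNReal.ofReal q * g (subsampleSum (fun i => U (j.succAbove i)) y.1 y.2 + U j η)) ∂ν j
        ∂(Measure.pi fun _ : Fin N => bernoulliMeasure true false q).prod
          (Measure.pi fun i => ν (j.succAbove i)) := by
  have e1 := (measurePreserving_piFinSuccAbove
    (fun _ : Fin (N + 1) => bernoulliMeasure true false q) j).symm
  have e2 := (measurePreserving_piFinSuccAbove ν j).symm
  have hgS : Measurable fun x : (Fin (N + 1) → Bool) × (Fin (N + 1) → Ω) =>
      g (subsampleSum U x.1 x.2) := hg.comp (measurable_subsampleSum hU)
  rw [← (e1.prod e2).lintegral_comp hgS]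
  refine (lintegral_prod_prod_comm _ _ _ _ (hgS.comp (e1.prod e2).measurable)).trans ?_
  refine lintegral_congr fun y => lintegral_congr fun η => ?_
  rw [lintegral_bernoulliMeasure_bool]
  have hsum (a : Bool) : subsampleSum U (j.insertNth (α := fun _ => Bool) a y.1)
      (j.insertNth (α := fun _ => Ω) η y.2) =
      (if a then U j η else 0) + subsampleSum (fun i => U (j.succAbove i)) y.1 y.2 := by
    simp [subsampleSum, Fin.sum_univ_succAbove _ j]
  have h0 := hsum false
  have h1 := hsum true
  simp only [Bool.false_eq_true, if_false, zero_add, if_true] at h0 h1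
  rw [add_comm (U j η)] at h1
  rw [← h1, ← h0]
  rfl

variable {α β C : ℝ} {σ : ℝ≥0}

theorem lintegral_subsampleSum_le_remove (h : α.HolderConjugate β) (q : unitInterval)
    (hσ : σ ≠ 0) (hC : 0 < C) (ν : Fin (N + 1) → Measure Ω) [∀ i, IsProbabilityMeasure (ν i)]
    {U : Fin (N + 1) → Ω → E} (hU : ∀ i, Measurable (U i)) (j : Fin (N + 1))
    (hUC : ∀ η, ‖U j η‖ ≤ C) {f : E → ℝ≥0∞} (hf : Measurable f) :
    ∫⁻ ω, f (subsampleSum U ω.1 ω.2.1 + ((σ : ℝ) * C) • ω.2.2)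
        ∂(Measure.pi fun _ : Fin (N + 1) => bernoulliMeasure true false q).prod
          ((Measure.pi ν).prod (stdGaussian E)) ≤
      ENNReal.ofReal (mixtureMoment α q (σ ^ 2)) ^ (1 / α) *
        (∫⁻ ω, f (subsampleSum (fun i => U (j.succAbove i)) ω.1 ω.2.1 + ((σ : ℝ) * C) • ω.2.2) ^ β
        ∂(Measure.pi fun _ : Fin N => bernoulliMeasure true false q).prod
          ((Measure.pi fun i => ν (j.succAbove i)).prod (stdGaussian E))) ^ (1 / β) := by
  have hU' (i : Fin N) : Measurable (U (j.succAbove i)) := hU _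
  rw [lintegral_subsampleSum_add_noise q ν hU _ hf,
    lintegral_subsampleSum_add_noise q _ hU' _ (hf.pow_const β),
    lintegral_subsampleSum_succAbove q ν hU j (measurable_gaussianAverage _ hf)]
  refine lintegral_le_of_forall_le h _
    ((measurable_gaussianAverage _ (hf.pow_const β)).comp (measurable_subsampleSum hU'))
    fun y => ?_
  -- The right-hand side does not depend on the samples η of client j, so their average disappears.
  refine (lintegral_mono fun η => subsampled_gaussianAverage_le h q.2.1 q.2.2 hσ hC (hUC η) hf
    _).trans ?_
  simp

theorem lintegral_subsampleSum_le_add (h : α.HolderConjugate β) (q : unitInterval)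
    (hσ : σ ≠ 0) (hC : 0 < C) (ν : Fin (N + 1) → Measure Ω) [∀ i, IsProbabilityMeasure (ν i)]
    {U : Fin (N + 1) → Ω → E} (hU : ∀ i, Measurable (U i)) (j : Fin (N + 1))
    (hUC : ∀ η, ‖U j η‖ ≤ C) {f : E → ℝ≥0∞} (hf : Measurable f) :
    ∫⁻ ω, f (subsampleSum (fun i => U (j.succAbove i)) ω.1 ω.2.1 + ((σ : ℝ) * C) • ω.2.2)
        ∂(Measure.pi fun _ : Fin N => bernoulliMeasure true false q).prod
          ((Measure.pi fun i => ν (j.succAbove i)).prod (stdGaussian E)) ≤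
      ENNReal.ofReal (mixtureMoment α q (σ ^ 2)) ^ (1 / α) *
        (∫⁻ ω, f (subsampleSum U ω.1 ω.2.1 + ((σ : ℝ) * C) • ω.2.2) ^ β
        ∂(Measure.pi fun _ : Fin (N + 1) => bernoulliMeasure true false q).prod
          ((Measure.pi ν).prod (stdGaussian E))) ^ (1 / β) := by
  have hU' (i : Fin N) : Measurable (U (j.succAbove i)) := hU _
  have hS := measurable_subsampleSum hU'
  have hA := measurable_gaussianAverage ((σ : ℝ) * C) (hf.pow_const β)
  have hm : Measurable fun x : ((Fin N → Bool) × (Fin N → Ω)) × Ω =>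
      ENNReal.ofReal (1 - q) * gaussianAverage (σ * C) (fun y => f y ^ β)
          (subsampleSum (fun i => U (j.succAbove i)) x.1.1 x.1.2)
        + ENNReal.ofReal q * gaussianAverage (σ * C) (fun y => f y ^ β)
          (subsampleSum (fun i => U (j.succAbove i)) x.1.1 x.1.2 + U j x.2) :=
    ((hA.comp (hS.comp measurable_fst)).const_mul _).add
      ((hA.comp ((hS.comp measurable_fst).add ((hU j).comp measurable_snd))).const_mul _)
  rw [lintegral_subsampleSum_add_noise q _ hU' _ hf,
    lintegral_subsampleSum_add_noise q ν hU _ (hf.pow_const β),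
    lintegral_subsampleSum_succAbove q ν hU j hA]
  refine lintegral_le_of_forall_le h _ hm.lintegral_prod_right' fun y => ?_
  -- Now client j sits on the right, so the average over its samples η has to be moved inside the
  -- power 1/β by a second use of Jensen.
  have h1 := lintegral_le_of_forall_le h (ν j) (hm.comp (measurable_prodMk_left (x := y)))
    fun η => gaussianAverage_le_subsampled h q.2.1 q.2.2 hσ hC (hUC η) hf
      (subsampleSum (fun i => U (j.succAbove i)) y.1 y.2)
  simpa using h1

end Subsample

/-! ### The rounds of the algorithm and their composition -/

theorem holderBound_map_iff {X X' Y : Type*} [MeasurableSpace X] [MeasurableSpace X']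
    [MeasurableSpace Y] {α β : ℝ} {M : ℝ≥0∞} {μ : Measure X} {ν : Measure X'} {g : X → Y}
    {g' : X' → Y} (hg : Measurable g) (hg' : Measurable g') :
    HolderBound α β M (μ.map g) (ν.map g') ↔ ∀ f : Y → ℝ≥0∞, Measurable f →
      ∫⁻ x, f (g x) ∂μ ≤ M ^ (1 / α) * (∫⁻ x, f (g' x) ^ β ∂ν) ^ (1 / β) := by
  refine forall₂_congr fun f hf => ?_
  rw [lintegral_map hf hg, lintegral_map (hf.pow_const β) hg']

variable {d : ℕ} {Ξ : Type*} [MeasurableSpace Ξ]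

theorem norm_clip_le (C : ℝ≥0) (v : Model d) : ‖clip C v‖ ≤ C := by
  rcases eq_or_ne v 0 with rfl | hv
  · simp [clip]
  have hv' : 0 < ‖v‖ := norm_pos_iff.2 hv
  have h0 : (0 : ℝ) ≤ min 1 ((C : ℝ) / ‖v‖) := by positivity
  rw [clip, norm_smul, Real.norm_of_nonneg h0]
  calc min 1 ((C : ℝ) / ‖v‖) * ‖v‖ ≤ (C : ℝ) / ‖v‖ * ‖v‖ := by
        gcongr; exact min_le_right _ _
    _ = C := div_mul_cancel₀ _ hv'.ne'

theorem measurable_clip_localUpdate (p : Params) (c : Client d Ξ) (x g : Model d) :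
    Measurable fun ξ : Fin p.K → Ξ => clip p.C (localUpdate p c ξ x g) := by
  have h : Measurable fun ξ : Fin p.K → Ξ => localUpdate p c ξ x g :=
    (((measurable_localRun p c p.K).comp (f := fun ξ : Fin p.K → Ξ => (ξ, x, g))
      (by fun_prop)).sub measurable_const).add measurable_const
  exact (measurable_const.min (h.norm.const_div _)).smul h

/-- The new state computed from the noisy sum `y` of the clipped updates. -/
noncomputable def serverUpdate (p : Params) (s : Model d × Model d) (y : Model d) : Model d × Model d :=
  let g' : Model d := (1 / (p.η * p.S * p.K)) • -(y - (p.S * ((1 - p.β) * p.K * p.η)) • s.2)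
  (s.1 - p.γ • g', g')

theorem measurable_serverUpdate (p : Params) (s : Model d × Model d) :
    Measurable (serverUpdate p s) := by
  unfold serverUpdate
  fun_prop

variable {α β : ℝ} {N : ℕ}

theorem measurable_round_left (p : Params) (c : Fin N → Client d Ξ) (s : Model d × Model d) :
    Measurable fun ω => round p c ω s :=
  (measurable_round p c).comp (measurable_id.prodMk measurable_const)

theorem measurable_run_left (p : Params) (c : Fin N → Client d Ξ) (R : ℕ)
    (s : Model d × Model d) : Measurable fun ω => run p c R ω s :=
  (measurable_run p c R).comp (measurable_id.prodMk measurable_const)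

/-- The law of the next state. -/
noncomputable def roundLaw (p : Params) (c : Fin N → Client d Ξ) (s : Model d × Model d) :
    Measure (Model d × Model d) :=
  (roundNoiseLaw p c).map fun ω => round p c ω s

/-- For a fixed state s, `round` is by definition `serverUpdate p s` applied to a noisy subsampled
sum of vectors of norm at most C, so the round is a post-processing of that sum. -/
theorem holderBound_roundLaw_remove (h : α.HolderConjugate β) (p : Params) (hC : 0 < p.C)
    (hσ : 0 < p.σ) (c : Fin (N + 1) → Client d Ξ) (j : Fin (N + 1)) (s : Model d × Model d) :
    HolderBound α β (ENNReal.ofReal (mixtureMoment α p.q (p.σ ^ 2))) (roundLaw p c s)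
      (roundLaw p (fun i => c (j.succAbove i)) s) :=
  (holderBound_map_iff (measurable_round_left p _ s) (measurable_round_left p _ s)).2 fun _ hf =>
    lintegral_subsampleSum_le_remove h p.q hσ.ne' (NNReal.coe_pos.2 hC) _
      (U := fun i ξ => clip p.C (localUpdate p (c i) ξ s.1 s.2))
      (fun i => measurable_clip_localUpdate p (c i) s.1 s.2) j (fun _ => norm_clip_le _ _)
      (hf.comp (measurable_serverUpdate p s))

theorem holderBound_roundLaw_add (h : α.HolderConjugate β) (p : Params) (hC : 0 < p.C)
    (hσ : 0 < p.σ) (c : Fin (N + 1) → Client d Ξ) (j : Fin (N + 1)) (s : Model d × Model d) :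
    HolderBound α β (ENNReal.ofReal (mixtureMoment α p.q (p.σ ^ 2)))
      (roundLaw p (fun i => c (j.succAbove i)) s) (roundLaw p c s) :=
  (holderBound_map_iff (measurable_round_left p _ s) (measurable_round_left p _ s)).2 fun _ hf =>
    lintegral_subsampleSum_le_add h p.q hσ.ne' (NNReal.coe_pos.2 hC) _
      (U := fun i ξ => clip p.C (localUpdate p (c i) ξ s.1 s.2))
      (fun i => measurable_clip_localUpdate p (c i) s.1 s.2) j (fun _ => norm_clip_le _ _)
      (hf.comp (measurable_serverUpdate p s))

/-- Markov property: the later rounds use fresh randomness and see the first one only through the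
state y it produced. -/
theorem lintegral_run_succ (p : Params) (c : Fin N → Client d Ξ) (R : ℕ) (s : Model d × Model d)
    {f : (Fin (R + 1) → Model d × Model d) → ℝ≥0∞} (hf : Measurable f) :
    ∫⁻ ω, f (run p c (R + 1) ω s) ∂(Measure.pi fun _ : Fin (R + 1) => roundNoiseLaw p c) =
      ∫⁻ y, ∫⁻ ω, f (Fin.cons y (run p c R ω y))
        ∂(Measure.pi fun _ : Fin R => roundNoiseLaw p c) ∂roundLaw p c s := by
  have e := (measurePreserving_piFinSuccAbove
    (fun _ : Fin (R + 1) => roundNoiseLaw p c) 0).symm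
  have hm : Measurable fun x : (Model d × Model d) × (Fin R → RoundNoise d Ξ N p.K) =>
      f (Fin.cons x.1 (run p c R x.2 x.1)) := by
    refine hf.comp (measurable_pi_lambda _ fun i => Fin.cases ?_ (fun k => ?_) i)
    · exact measurable_fst
    · exact (measurable_pi_apply k).comp ((measurable_run p c R).comp measurable_swap)
  have hrun : Measurable fun ω => f (run p c (R + 1) ω s) := hf.comp (measurable_run_left p c (R + 1) s)
  rw [roundLaw, lintegral_map hm.lintegral_prod_right' (measurable_round_left p c s),
    ← e.lintegral_comp hrun]
  exact lintegral_prod _ (hrun.comp e.measurable).aemeasurable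

/-- Adaptive composition over the rounds. -/
theorem holderBound_run (h : α.HolderConjugate β) (p : Params) {N' : ℕ}
    (c : Fin N → Client d Ξ) (c' : Fin N' → Client d Ξ) {M : ℝ≥0∞}
    (H : ∀ s, HolderBound α β M (roundLaw p c s) (roundLaw p c' s)) (R : ℕ)
    (s : Model d × Model d) {f : (Fin R → Model d × Model d) → ℝ≥0∞} (hf : Measurable f) :
    ∫⁻ ω, f (run p c R ω s) ∂(Measure.pi fun _ : Fin R => roundNoiseLaw p c) ≤
      (M ^ R) ^ (1 / α) * (∫⁻ ω, f (run p c' R ω s) ^ β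
        ∂(Measure.pi fun _ : Fin R => roundNoiseLaw p c')) ^ (1 / β) := by
  induction R generalizing s with
  | zero =>
    have hβ : β * β⁻¹ = 1 := mul_inv_cancel₀ h.symm.ne_zero
    simp [run, ← ENNReal.rpow_mul, hβ]
  | succ R ih =>
    have hcons (y : Model d × Model d) :
        Measurable fun x : Fin R → Model d × Model d => f (Fin.cons y x) := by
      refine hf.comp (measurable_pi_lambda _ fun i => Fin.cases ?_ (fun k => ?_) i)
      · exact measurable_const
      · exact measurable_pi_apply k
    have hm : Measurable fun x : (Model d × Model d) × (Fin R → RoundNoise d Ξ N' p.K) =>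
        f (Fin.cons x.1 (run p c' R x.2 x.1)) ^ β := by
      refine (hf.comp (measurable_pi_lambda _ fun i => Fin.cases ?_ (fun k => ?_) i)).pow_const β
      · exact measurable_fst
      · exact (measurable_pi_apply k).comp ((measurable_run p c' R).comp measurable_swap)
    have hG : Measurable fun y => ∫⁻ ω, f (Fin.cons y (run p c' R ω y)) ^ β
        ∂(Measure.pi fun _ : Fin R => roundNoiseLaw p c') := hm.lintegral_prod_right'
    rw [lintegral_run_succ p c R s hf, lintegral_run_succ p c' R s (hf.pow_const β)]
    -- The induction hypothesis bounds the remaining rounds from each y; the one-round bound is then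
    -- tested on the resulting function of y, whose exponent 1/β cancels against β.
    calc _ ≤ ∫⁻ y, (M ^ R) ^ (1 / α) * (∫⁻ ω, f (Fin.cons y (run p c' R ω y)) ^ β
          ∂(Measure.pi fun _ : Fin R => roundNoiseLaw p c')) ^ (1 / β) ∂roundLaw p c s :=
          lintegral_mono fun y => ih y (hcons y)
      _ = (M ^ R) ^ (1 / α) * ∫⁻ y, (∫⁻ ω, f (Fin.cons y (run p c' R ω y)) ^ β
          ∂(Measure.pi fun _ : Fin R => roundNoiseLaw p c')) ^ (1 / β) ∂roundLaw p c s :=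
          lintegral_const_mul _ (hG.pow_const _)
      _ ≤ (M ^ R) ^ (1 / α) * (M ^ (1 / α) * (∫⁻ y, ((∫⁻ ω, f (Fin.cons y (run p c' R ω y)) ^ β
          ∂(Measure.pi fun _ : Fin R => roundNoiseLaw p c')) ^ (1 / β)) ^ β
            ∂roundLaw p c' s) ^ (1 / β)) := by
          gcongr
          exact H s _ (hG.pow_const _)
      _ = _ := by
          rw [pow_succ, ENNReal.mul_rpow_of_nonneg _ _ (one_div_nonneg.2 h.nonneg), mul_assoc]
          simp_rw [one_div, ENNReal.rpow_inv_rpow h.symm.ne_zero]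

theorem holderBound_mechanism (h : α.HolderConjugate β) (p : Params) (hC : 0 < p.C)
    (hσ : 0 < p.σ) (R : ℕ) (x₀ g₀ : Model d) {D D' : Dataset d Ξ} (hD : Adjacent D D') :
    HolderBound α β (ENNReal.ofReal (mixtureMoment α p.q (p.σ ^ 2)) ^ R)
      (mechanism p R x₀ g₀ D) (mechanism p R x₀ g₀ D') := by
  refine (holderBound_map_iff (measurable_run_left p _ R _) (measurable_run_left p _ R _)).2
    fun f hf => ?_
  refine holderBound_run h p D.2 D'.2 ?_ R _ hf
  rcases hD with ⟨N, c, j, rfl, rfl⟩ | ⟨N, c, j, rfl, rfl⟩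
  · exact holderBound_roundLaw_remove h p hC hσ c j
  · exact holderBound_roundLaw_add h p hC hσ c j

/-! ### The privacy budget -/

theorem rdpBudget_eq (R : ℕ) (q : ℝ) (σ : ℝ≥0) (α : ℝ) :
    rdpBudget R q σ α = (α - 1)⁻¹ * Real.log (mixtureMoment α q (σ ^ 2) ^ R) := by
  rw [rdpBudget, funext (ratioPow_eq q σ α), Real.log_pow, mixtureMoment]
  ring

theorem mixtureMoment_pos (hα : 0 ≤ α) {q : ℝ} (hq0 : 0 ≤ q) (hq1 : q ≤ 1)
    {v : ℝ≥0} (hv : v ≠ 0) : 0 < mixtureMoment α q v := by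
  refine (integral_pos_iff_support_of_nonneg
    (fun z => Real.rpow_nonneg (mixtureRatio_pos hq0 hq1 hv z).le _)
    (integrable_mixtureRatio_rpow hα hq0 hq1 hv)).2 ?_
  rw [Function.support_eq_univ fun z =>
    (Real.rpow_pos_of_pos (mixtureRatio_pos hq0 hq1 hv z) _).ne']
  simp

end DPFedPGN

theorem mainTheorem2 {d : ℕ} {Ξ : Type*} [MeasurableSpace Ξ]
    (p : DPFedPGN.Params) (hK : 0 < p.K) (hS : 0 < p.S) (hη : 0 < p.η) (hC : 0 < p.C)
    (hσ : 0 < p.σ) (R : ℕ) (x₀ g₀ : DPFedPGN.Model d)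
    (α δ : ℝ) (hα : 1 < α) (hδ : 0 < δ) :
    MeasureTheory.Integrable (DPFedPGN.ratioPow p.q p.σ α)
        (ProbabilityTheory.gaussianReal 0 (p.σ ^ 2)) ∧
      DPFedPGN.IsRDP DPFedPGN.Adjacent
        (DPFedPGN.mechanism (Ξ := Ξ) p R x₀ g₀) α
        (DPFedPGN.rdpBudget R p.q p.σ α) ∧
      DPFedPGN.IsDP DPFedPGN.Adjacent
        (DPFedPGN.mechanism (Ξ := Ξ) p R x₀ g₀)
        (DPFedPGN.dpBudget R p.q p.σ α δ) δ := by
  have h : α.HolderConjugate (Real.conjExponent α) := .conjExponent hα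
  have hv : p.σ ^ 2 ≠ 0 := pow_ne_zero 2 hσ.ne'
  have hm := DPFedPGN.mixtureMoment_pos h.nonneg p.q.2.1 p.q.2.2 hv
  have H (D D' : DPFedPGN.Dataset d Ξ) (hD : DPFedPGN.Adjacent D D') :=
    DPFedPGN.holderBound_mechanism h p hC hσ R x₀ g₀ hD
  simp_rw [← ENNReal.ofReal_pow hm.le] at H
  refine ⟨DPFedPGN.integrable_ratioPow h.nonneg p.q.2.1 p.q.2.2 hσ.ne', fun D D' hD => ?_,
    fun D D' hD O hO => ?_⟩
  · rw [DPFedPGN.rdpBudget_eq]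
    exact (H D D' hD).renyiDiv_le h (pow_pos hm R)
  · rw [DPFedPGN.dpBudget, DPFedPGN.rdpBudget_eq]
    exact (H D D' hD).measure_le_exp_mul_add h (pow_pos hm R) hδ hO
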